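/- Let $X_0,X_1,X_2,\dots$ be real random variables on a probability space and let $0<S_0<S_1<S_2<\cdots$ be integer-valued random variables on it. Put $W_0=S_0$, $W_k=S_k-S_{k-1}$ for $k\ge1$, and $Y_0=\max_{0\le j<S_0}X_j$, $Y_k=\max_{S_{k-1}\le j<S_k}X_j$ for $k\ge 1$. Assume that the pairs $(W_0,Y_0),(W_1,Y_1),(W_2,Y_2),\dots$ are independent and that $(W_1,Y_1),(W_2,Y_2),\dots$ are identically distributed. A distribution function $G$ is called a phantom distribution function for $\{X_j\}$ if, with $M_n=\max_{1\le j\le n}X_j$, one has $P(M_n\le u_n)-G(u_n)^n\to0$ as $n\to\infty$ for every real sequence $\{u_n\}$ (equivalently, $\sup_{u\in\mathbb R}|P(M_n\le u)-G(u)^n|\to0$). A distribution function $G$ with right end $G_*=\sup\{x: G(x)<1\}\in(-\infty,+\infty]$ is called regular if $G(G_*-)=1$ and $\lim_{x\to G_*-}\frac{1-G(x-)}{1-G(x)}=1$. Suppose that $\mu=E\,W_1<+\infty$ and that $P\big(Y_0>\max_{1\le j\le n}Y_j\big)\to0$ as $n\to\infty$. Then $\{X_j\}$ admits a continuous phantom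 distribution function if and only if the distribution function $x\mapsto P(Y_1\le x)$ of $Y_1$ is regular. In that case $G(x)=P(Y_1\le x)^{1/\mu}$ is a regular phantom distribution function for $\{X_j\}$. -/

import Mathlib

open MeasureTheory ProbabilityTheory Filter Topology

noncomputable section

/-- `G` is the distribution function of a (proper) probability law on the real line. -/
structure IsDistributionFunction (G : ℝ → ℝ) : Prop where
  monotone : Monotone G
  rightContinuous : ∀ x, ContinuousWithinAt G (Set.Ici x) x
  tendsto_atBot : Tendsto G atBot (𝓝 0)
  tendsto_atTop : Tendsto G atTop (𝓝 1)

/-- The right end `G_* = sup {x : G x < 1}`, an extended real number. -/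
def rightEnd (G : ℝ → ℝ) : EReal :=
  sSup ((fun x : ℝ => (x : EReal)) '' {x : ℝ | G x < 1})

/-- The filter on the reals describing `x → G_*-`; it covers both the case of a finite right end
and the case `G_* = +∞`. -/
def toRightEnd (G : ℝ → ℝ) : Filter ℝ :=
  comap (fun x : ℝ => (x : EReal)) (𝓝[<] (rightEnd G))

/-- Regularity in the sense of O'Brien:
`G (G_*-) = 1` and `(1 - G (x-)) / (1 - G x) → 1` as `x → G_*-`. -/
structure IsRegularDF (G : ℝ → ℝ) : Prop where
  isDistributionFunction : IsDistributionFunction G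
  tendsto_one : Tendsto G (toRightEnd G) (𝓝 1)
  tendsto_ratio :
    Tendsto (fun x => (1 - Function.leftLim G x) / (1 - G x)) (toRightEnd G) (𝓝 1)

/-- Maximum of `f` over a nonempty finite set of indices (by convention `0` if the set is empty). -/
def maxOver (s : Finset ℕ) (f : ℕ → ℝ) : ℝ :=
  if h : s.Nonempty then s.sup' h f else 0

variable {Ω : Type*}

/-- The partial maximum `M_n = max_{1 ≤ j ≤ n} X_j`, `n ≥ 1`. -/
def partialMax (X : ℕ → Ω → ℝ) (n : ℕ) (ω : Ω) : ℝ :=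
  maxOver (Finset.Icc 1 n) (fun j => X j ω)

/-- `G` is a phantom distribution function for the sequence `X`:
`P(M_n ≤ u_n) - G(u_n)^n → 0` for every real sequence `u`. -/
structure IsPhantomDF [MeasurableSpace Ω] (P : Measure Ω) (X : ℕ → Ω → ℝ) (G : ℝ → ℝ) :
    Prop where
  isDistributionFunction : IsDistributionFunction G
  tendsto_zero : ∀ u : ℕ → ℝ,
    Tendsto (fun n => P.real {ω | partialMax X n ω ≤ u n} - G (u n) ^ n) atTop (𝓝 0)

/-- The first index of the `k`-th cycle: `0` for the initial cycle, `S_{k-1}` for `k ≥ 1`. -/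
def cycleStart (S : ℕ → Ω → ℕ) : ℕ → Ω → ℕ
  | 0, _ => 0
  | k + 1, ω => S k ω

/-- The cycle lengths `W_0 = S_0` and `W_k = S_k - S_{k-1}` for `k ≥ 1`. -/
def cycleLength (S : ℕ → Ω → ℕ) (k : ℕ) (ω : Ω) : ℕ :=
  S k ω - cycleStart S k ω

/-- The cycle maxima `Y_0 = max_{0 ≤ j < S_0} X_j` and `Y_k = max_{S_{k-1} ≤ j < S_k} X_j`
for `k ≥ 1`. -/
def cycleMax (X : ℕ → Ω → ℝ) (S : ℕ → Ω → ℕ) (k : ℕ) (ω : Ω) : ℝ :=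
  maxOver (Finset.Ico (cycleStart S k ω) (S k ω)) (fun j => X j ω)

/-- The random times `0 < S_0 < S_1 < ⋯` are regeneration times for the process `X`, at the level
of cycle lengths and cycle maxima: the pairs `(W_k, Y_k)`, `k ≥ 0`, are independent, and those with
`k ≥ 1` are identically distributed. -/
structure IsRegenerative [MeasurableSpace Ω] (P : Measure Ω) (X : ℕ → Ω → ℝ)
    (S : ℕ → Ω → ℕ) : Prop where
  measurable_process : ∀ j, Measurable (X j)
  measurable_time : ∀ k, Measurable (S k)
  time_pos : ∀ ω, 0 < S 0 ω
  time_lt : ∀ k ω, S k ω < S (k + 1) ω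
  indep : iIndepFun (fun k ω => (cycleLength S k ω, cycleMax X S k ω)) P
  identDistrib : ∀ k, 1 ≤ k →
    IdentDistrib (fun ω => (cycleLength S k ω, cycleMax X S k ω))
      (fun ω => (cycleLength S 1 ω, cycleMax X S 1 ω)) P P

/-- The mean cycle length `μ = E W_1`. -/
def meanCycleLength [MeasurableSpace Ω] (P : Measure Ω) (S : ℕ → Ω → ℕ) : ℝ :=
  ∫ ω, (cycleLength S 1 ω : ℝ) ∂P

/-- The distribution function `x ↦ P(Y_1 ≤ x)` of the cycle maximum. -/
def cycleMaxDF [MeasurableSpace Ω] (P : Measure Ω) (X : ℕ → Ω → ℝ) (S : ℕ → Ω → ℕ)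
    (x : ℝ) : ℝ :=
  P.real {ω | cycleMax X S 1 ω ≤ x}

end

/-! Write `F` for the law of `Y_1` and `G = F^(1/μ)`. By the law of large numbers `S_m` is close to
`m μ`, so up to events of small probability `M_n` lies between maxima of about `n / μ` independent
cycle maxima, each such maximum over `m` cycles having distribution function `F^m`; the initial
cycle is negligible by assumption. Changing the exponent by a factor near 1 changes `F^m` little,
uniformly in the argument. Hence `G` is a phantom distribution function whether or not `F` is
regular (`IsRegenerative.isPhantomDF_cycleMaxDF_rpow`).

The rest is analysis: is there a continuous `H` with `H^n - G^n → 0` uniformly? If so, the jumps of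
`G^n` are uniformly small. With `p = 1 - G(x-)` and `n` about `1/(2p)`, the jump of `G^n` at `x` is
at least a constant times the jump of `G` divided by `p`, so the latter is `o(p)`: this is
regularity (`isRegularDF_of_continuous`). Conversely, a regular `G` has a continuous `H` with an
equivalent tail (`IsRegularDF.exists_continuous_tail`), and tail equivalence makes the `n`-th powers
uniformly close (`tendsto_pow_sub_pow_of_tail`). Regularity passes between `F` and `G` because `1 -
t^c ~ c (1 - t)` as `t → 1`. -/

/-! ### The filter at the right end -/

theorem IsDistributionFunction.nonneg {G : ℝ → ℝ} (hG : IsDistributionFunction G) (x : ℝ) :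
    0 ≤ G x :=
  hG.monotone.le_of_tendsto hG.tendsto_atBot x

theorem IsDistributionFunction.le_one {G : ℝ → ℝ} (hG : IsDistributionFunction G) (x : ℝ) :
    G x ≤ 1 :=
  hG.monotone.ge_of_tendsto hG.tendsto_atTop x

theorem IsDistributionFunction.coe_lt_rightEnd_iff {G : ℝ → ℝ} (hG : IsDistributionFunction G)
    (x : ℝ) : (x : EReal) < rightEnd G ↔ G x < 1 := by
  constructor
  · intro h
    obtain ⟨_, ⟨y, hy, rfl⟩, hxy⟩ := lt_sSup_iff.1 h
    exact (hG.monotone (EReal.coe_lt_coe_iff.1 hxy).le).trans_lt hy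
  · intro h
    have h1 : ∀ᶠ y in 𝓝[>] x, G y < 1 :=
      ((hG.rightContinuous x).mono Set.Ioi_subset_Ici_self).eventually (gt_mem_nhds h)
    obtain ⟨y, hy, hxy⟩ := (h1.and self_mem_nhdsWithin).exists
    exact (EReal.coe_lt_coe_iff.2 hxy).trans_le (le_sSup ⟨y, hy, rfl⟩)

theorem IsDistributionFunction.exists_lt_one {G : ℝ → ℝ} (hG : IsDistributionFunction G) :
    ∃ x, G x < 1 :=
  (hG.tendsto_atBot.eventually (gt_mem_nhds one_pos)).exists

theorem IsDistributionFunction.hasBasis_toRightEnd {G : ℝ → ℝ} (hG : IsDistributionFunction G) :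
    (toRightEnd G).HasBasis (fun a => G a < 1) (fun a => {x | a < x ∧ G x < 1}) := by
  obtain ⟨z, hz⟩ := hG.exists_lt_one
  have hz' := (hG.coe_lt_rightEnd_iff z).2 hz
  refine ((nhdsLT_basis_of_exists_lt ⟨_, hz'⟩).comap _).to_hasBasis ?_ ?_
  · intro a ha
    obtain ⟨y, hay, hy⟩ := EReal.lt_iff_exists_real_btwn.1 ha
    refine ⟨y, (hG.coe_lt_rightEnd_iff y).1 hy, fun x hx => ⟨?_, ?_⟩⟩
    · exact hay.trans (EReal.coe_lt_coe_iff.2 hx.1)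
    · exact (hG.coe_lt_rightEnd_iff x).2 hx.2
  · intro a ha
    refine ⟨a, (hG.coe_lt_rightEnd_iff a).2 ha, fun x hx => ⟨?_, ?_⟩⟩
    · exact EReal.coe_lt_coe_iff.1 hx.1
    · exact (hG.coe_lt_rightEnd_iff x).1 hx.2

theorem IsDistributionFunction.tendsto_toRightEnd {G : ℝ → ℝ} (hG : IsDistributionFunction G)
    (h : ∀ ε > 0, ∃ x, G x < 1 ∧ 1 - ε < G x) : Tendsto G (toRightEnd G) (𝓝 1) := by
  refine tendsto_order.2 ⟨fun a ha => ?_, fun a ha => Eventually.of_forall fun x =>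
    (hG.le_one x).trans_lt ha⟩
  obtain ⟨x, hx, hx'⟩ := h (1 - a) (by linarith)
  refine hG.hasBasis_toRightEnd.mem_of_mem hx |> mem_of_superset <| fun y hy => ?_
  have := hG.monotone hy.1.le
  show a < G y
  linarith

theorem IsDistributionFunction.tendsto_leftLim_toRightEnd {G : ℝ → ℝ}
    (hG : IsDistributionFunction G) (h : Tendsto G (toRightEnd G) (𝓝 1)) :
    Tendsto (Function.leftLim G) (toRightEnd G) (𝓝 1) := by
  refine tendsto_order.2 ⟨fun a ha => ?_, fun a ha => Eventually.of_forall fun x =>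
    ((hG.monotone.leftLim_le le_rfl).trans (hG.le_one x)).trans_lt ha⟩
  obtain ⟨b, hb, hb'⟩ := hG.hasBasis_toRightEnd.eventually_iff.1 (h.eventually (lt_mem_nhds ha))
  -- The left limit at `y` only dominates values strictly before `y`, hence a second point `c`
  -- beyond `b`.
  obtain ⟨c, hbc, hc⟩ : ∃ c, b < c ∧ G c < 1 := by
    obtain ⟨c, h1, h2⟩ := EReal.lt_iff_exists_real_btwn.1 ((hG.coe_lt_rightEnd_iff b).2 hb)
    exact ⟨c, EReal.coe_lt_coe_iff.1 h1, (hG.coe_lt_rightEnd_iff c).1 h2⟩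
  refine mem_of_superset (hG.hasBasis_toRightEnd.mem_of_mem hc) fun y hy => ?_
  exact (hb' ⟨hbc, hc⟩).trans_le (hG.monotone.le_leftLim hy.1)

theorem IsDistributionFunction.eventually_lt_one {G : ℝ → ℝ} (hG : IsDistributionFunction G) :
    ∀ᶠ x in toRightEnd G, G x < 1 := by
  obtain ⟨z, hz⟩ := hG.exists_lt_one
  exact mem_of_superset (hG.hasBasis_toRightEnd.mem_of_mem hz) fun y hy => hy.2

/-! ### Powers of distribution functions -/

theorem IsDistributionFunction.rpow {G : ℝ → ℝ} (hG : IsDistributionFunction G) {c : ℝ}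
    (hc : 0 < c) : IsDistributionFunction (fun x => G x ^ c) where
  monotone _ _ h := Real.rpow_le_rpow (hG.nonneg _) (hG.monotone h) hc.le
  rightContinuous x := (hG.rightContinuous x).rpow_const (Or.inr hc.le)
  tendsto_atBot := by
    simpa [Real.zero_rpow hc.ne'] using hG.tendsto_atBot.rpow_const (Or.inr hc.le)
  tendsto_atTop := by
    simpa using hG.tendsto_atTop.rpow_const (Or.inr hc.le)

theorem IsDistributionFunction.rpow_lt_one_iff {G : ℝ → ℝ} (hG : IsDistributionFunction G) {c : ℝ}
    (hc : 0 < c) (x : ℝ) : G x ^ c < 1 ↔ G x < 1 := by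
  rw [← Real.rpow_lt_rpow_iff (hG.nonneg x) zero_le_one hc, Real.one_rpow]

theorem tendsto_one_sub_rpow_div (c : ℝ) :
    Tendsto (fun t : ℝ => (1 - t ^ c) / (1 - t)) (𝓝[≠] 1) (𝓝 c) := by
  have h := (Real.hasDerivAt_rpow_const (x := 1) (p := c) (Or.inl one_ne_zero)).tendsto_slope
  simp only [Real.one_rpow, mul_one] at h
  refine h.congr fun t => ?_
  rw [slope_def_field, Real.one_rpow, ← neg_sub, ← neg_sub 1 t, neg_div_neg_eq]

theorem IsRegularDF.rpow {G : ℝ → ℝ} (hG : IsRegularDF G) {c : ℝ} (hc : 0 < c) :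
    IsRegularDF (fun x => G x ^ c) := by
  have hd := hG.isDistributionFunction
  have hend : toRightEnd (fun x => G x ^ c) = toRightEnd G := by
    simp only [toRightEnd, rightEnd, hd.rpow_lt_one_iff hc]
  have hleft : ∀ x, Function.leftLim (fun x => G x ^ c) x = Function.leftLim G x ^ c := fun x =>
    leftLim_eq_of_tendsto
      ((hd.monotone.tendsto_leftLim x).rpow_const (Or.inr hc.le))
  refine ⟨hd.rpow hc, ?_, ?_⟩
  · rw [hend]
    simpa using hG.tendsto_one.rpow_const (Or.inr hc.le)
  · rw [hend]
    have hlt : ∀ᶠ x in toRightEnd G, Function.leftLim G x < 1 := hd.eventually_lt_one.mono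
      fun x hx => (hd.monotone.leftLim_le le_rfl).trans_lt hx
    have h1 := (tendsto_one_sub_rpow_div c).comp
      (tendsto_nhdsWithin_iff.2 ⟨hd.tendsto_leftLim_toRightEnd hG.tendsto_one,
        hlt.mono fun x hx => hx.ne⟩)
    have h2 := (tendsto_one_sub_rpow_div c).comp
      (tendsto_nhdsWithin_iff.2 ⟨hG.tendsto_one, hd.eventually_lt_one.mono fun x hx => hx.ne⟩)
    have h3 := (h1.mul hG.tendsto_ratio).div h2 hc.ne'
    rw [mul_one, div_self hc.ne'] at h3
    refine h3.congr' ?_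
    filter_upwards [hd.eventually_lt_one, hlt] with x hx hx'
    have e1 : 1 - G x ≠ 0 := by linarith
    have e2 : 1 - Function.leftLim G x ≠ 0 := by linarith
    have e3 : 1 - G x ^ c ≠ 0 := by
      have := (hd.rpow_lt_one_iff hc x).2 hx
      linarith
    simp only [Function.comp_apply, hleft, Pi.div_apply]
    field_simp

/-! ### Elementary inequalities for powers -/

/-- The difference of powers is `(x - y) ∑ x^i y^(n-i)`, with `n + 1` terms between `y^n` and `x^n`.
-/
theorem succ_mul_sub_mul_pow_le_pow_sub_pow {x y : ℝ} (hy : 0 ≤ y) (hxy : y ≤ x) (n : ℕ) :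
    (n + 1) * (x - y) * y ^ n ≤ x ^ (n + 1) - y ^ (n + 1) := by
  induction n with
  | zero => simp
  | succ n ih =>
    have h1 := mul_le_mul_of_nonneg_left ih hy
    have h2 : y ^ (n + 1) ≤ x ^ (n + 1) := pow_le_pow_left₀ hy hxy _
    have h3 := mul_le_mul_of_nonneg_right hxy (sub_nonneg.2 h2)
    push_cast
    linear_combination h1 + h3

theorem pow_sub_pow_le_succ_mul_sub_mul_pow {x y : ℝ} (hy : 0 ≤ y) (hxy : y ≤ x) (n : ℕ) :
    x ^ (n + 1) - y ^ (n + 1) ≤ (n + 1) * (x - y) * x ^ n := by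
  induction n with
  | zero => simp
  | succ n ih =>
    have h1 := mul_le_mul_of_nonneg_left ih (hy.trans hxy)
    have h2 : y ^ (n + 1) ≤ x ^ (n + 1) := pow_le_pow_left₀ hy hxy _
    have h3 := mul_le_mul_of_nonneg_left h2 (sub_nonneg.2 hxy)
    push_cast
    linear_combination h1 + h3

/-- Bernoulli's inequality for `s = t^b` and exponent `a / b ≤ 1`. The bound does not depend on `t`,
so exponents can be exchanged uniformly in the level `u`. -/
theorem rpow_sub_rpow_le {t a b : ℝ} (ht : 0 ≤ t) (ha : 0 ≤ a) (hb : 0 < b)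
    (hab : a ≤ b) : t ^ a - t ^ b ≤ 1 - a / b := by
  have h := rpow_one_add_le_one_add_mul_self (s := t ^ b - 1) (p := a / b)
    (by linarith [Real.rpow_nonneg ht b]) (by positivity) ((div_le_one hb).2 hab)
  rw [add_sub_cancel, ← Real.rpow_mul ht, mul_div_cancel₀ _ hb.ne'] at h
  have h1 : a / b ≤ 1 := (div_le_one hb).2 hab
  nlinarith [Real.rpow_nonneg ht b]

/-! ### Regularity from asymptotic continuity of the powers -/

/-- A sequence of functions that vanishes along every sequence of arguments vanishes uniformly. -/
theorem eventually_forall_abs_le_of_forall_tendsto {f : ℕ → ℝ → ℝ}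
    (h : ∀ u : ℕ → ℝ, Tendsto (fun n => f n (u n)) atTop (𝓝 0)) {ε : ℝ} (hε : 0 < ε) :
    ∀ᶠ n in atTop, ∀ x, |f n x| ≤ ε := by
  classical
  let u : ℕ → ℝ := fun n => if H : ∃ x, ε < |f n x| then H.choose else 0
  have hu := (h u).eventually (Metric.closedBall_mem_nhds 0 hε)
  filter_upwards [hu] with n hn x
  by_contra! hx
  have H : ∃ x, ε < |f n x| := ⟨x, hx⟩
  have h1 := H.choose_spec
  have h2 : u n = H.choose := dif_pos H
  rw [← h2] at h1
  simp only [dist_zero_right, Real.norm_eq_abs] at hn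
  linarith

theorem isRegularDF_of_continuous {G H : ℝ → ℝ} (hG : IsDistributionFunction G)
    (hH : IsDistributionFunction H) (hHc : Continuous H)
    (h : ∀ u : ℕ → ℝ, Tendsto (fun n => H (u n) ^ n - G (u n) ^ n) atTop (𝓝 0)) :
    IsRegularDF G := by
  have hunif : ∀ ε > 0, ∀ᶠ n : ℕ in atTop, ∀ x, |H x ^ n - G x ^ n| ≤ ε :=
    fun ε hε => eventually_forall_abs_le_of_forall_tendsto (f := fun n x => H x ^ n - G x ^ n) h hε
  -- `H^n` has no jumps: compare at `x` and at `y ↑ x`.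
  have hjump : ∀ ε > 0, ∀ᶠ n : ℕ in atTop,
      ∀ x, G x ^ n - Function.leftLim G x ^ n ≤ ε := by
    intro ε hε
    filter_upwards [hunif (ε / 2) (by positivity)] with n hn x
    have h1 : Tendsto (fun y => |H y ^ n - G y ^ n|) (𝓝[<] x)
        (𝓝 |H x ^ n - Function.leftLim G x ^ n|) :=
      (((hHc.tendsto x).mono_left nhdsWithin_le_nhds).pow n |>.sub
        ((hG.monotone.tendsto_leftLim x).pow n)).abs
    have h2 := le_of_tendsto h1 (Eventually.of_forall hn)
    linarith [abs_le.1 h2, abs_le.1 (hn x)]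
  have htwo : Tendsto G (toRightEnd G) (𝓝 1) := by
    refine hG.tendsto_toRightEnd fun ε hε => ?_
    obtain ⟨δ, hδ, hδε, hδ1⟩ : ∃ δ > 0, δ < ε ∧ δ < 1 :=
      ⟨min ε 1 / 2, by positivity, by linarith [min_le_left ε 1, lt_min hε one_pos],
        by linarith [min_le_right ε 1]⟩
    have hpow : Tendsto (fun n : ℕ => (1 - δ) ^ n) atTop (𝓝 0) :=
      tendsto_pow_atTop_nhds_zero_of_lt_one (by linarith) (by linarith)
    obtain ⟨n, h1, h2, hn⟩ := ((hunif (1 / 8) (by norm_num)).and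
      ((hpow.eventually (gt_mem_nhds (show (0 : ℝ) < 1 / 4 by norm_num))).and
        (eventually_ge_atTop 1))).exists
    have hn0 : n ≠ 0 := by omega
    -- At such a point `G x ^ n` lies within `1/8` of `1/2`: too small for `G x ≥ 1`, too large for
    -- `G x ≤ 1 - δ`.
    obtain ⟨x, hx⟩ : ∃ x, H x ^ n = 1 / 2 := by
      have ht0 := hH.tendsto_atBot.pow n
      have ht1 := hH.tendsto_atTop.pow n
      rw [zero_pow hn0] at ht0
      rw [one_pow] at ht1
      obtain ⟨a, ha⟩ := (ht0.eventually (gt_mem_nhds (show (0 : ℝ) < 1 / 2 by norm_num))).exists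
      obtain ⟨b, hb⟩ := (ht1.eventually (lt_mem_nhds (show (1 / 2 : ℝ) < 1 by norm_num))).exists
      exact mem_range_of_exists_le_of_exists_ge (hHc.pow n) ⟨a, ha.le⟩ ⟨b, hb.le⟩
    have h3 := abs_le.1 (h1 x)
    rw [hx] at h3
    refine ⟨x, ?_, ?_⟩
    · by_contra! hc
      have := one_le_pow₀ hc (n := n)
      linarith
    · by_contra! hc
      have := pow_le_pow_left₀ (hG.nonneg x) (hc.trans (by linarith : 1 - ε ≤ 1 - δ)) n
      linarith
  refine ⟨hG, htwo, ?_⟩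
  have hleft := hG.tendsto_leftLim_toRightEnd htwo
  have key : Tendsto (fun x => (1 - G x) / (1 - Function.leftLim G x)) (toRightEnd G) (𝓝 1) := by
    refine tendsto_order.2 ⟨fun a ha => ?_, fun a ha => ?_⟩
    · obtain ⟨N, hN⟩ := eventually_atTop.1 (hjump ((1 - a) / 16) (by linarith))
      have hp : ∀ᶠ x in toRightEnd G, 1 - 1 / (4 * ((N : ℝ) + 1)) < Function.leftLim G x :=
        hleft.eventually (lt_mem_nhds (by
          have : (0 : ℝ) < 1 / (4 * ((N : ℝ) + 1)) := by positivity
          linarith))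
      filter_upwards [hp, hG.eventually_lt_one] with x hx hx1
      set p := 1 - Function.leftLim G x with hp'
      have hle := hG.monotone.leftLim_le (le_refl x)
      have hp0 : 0 < p := by linarith
      have hpN : p < 1 / (4 * ((N : ℝ) + 1)) := by linarith
      have hN1 : 4 * ((N : ℝ) + 1) < 1 / p := by
        rw [lt_div_iff₀ hp0]
        rw [lt_div_iff₀ (by positivity)] at hpN
        linarith
      -- `n p ≤ 1/2` keeps `G(x-)^n ≥ 1/2` by Bernoulli, while `n + 1 > 1/(2p)`; so the jump of
      -- `G^(n+1)` is at least the jump of `G` over `4p`. The bound on `p` ensures `n + 1 ≥ N`.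
      set n := ⌊1 / (2 * p)⌋₊ with hn
      have h2p : 1 / (2 * p) = (1 / p) / 2 := by field_simp
      have hn1 : (n : ℝ) ≤ (1 / p) / 2 := by
        rw [← h2p]; exact Nat.floor_le (by positivity)
      have hn2 : (1 / p) / 2 < n + 1 := by
        rw [← h2p]; exact Nat.lt_floor_add_one _
      have hNn : N ≤ n + 1 := by
        have : (N : ℝ) ≤ n + 1 := by linarith [(Nat.cast_nonneg N : (0:ℝ) ≤ N)]
        exact_mod_cast this
      have h0 : 0 ≤ Function.leftLim G x := by
        have : 1 / (4 * ((N : ℝ) + 1)) ≤ 1 := by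
          rw [div_le_one (by positivity)]
          linarith [(Nat.cast_nonneg N : (0:ℝ) ≤ N)]
        linarith
      have h1 := succ_mul_sub_mul_pow_le_pow_sub_pow h0 hle n
      have h2 := hN (n + 1) hNn x
      have h3 : 1 / 2 ≤ Function.leftLim G x ^ n := by
        have := one_add_mul_le_pow (a := -p) (by linarith) n
        have h4 : (n : ℝ) * p ≤ 1 / 2 := by
          calc (n : ℝ) * p ≤ (1 / p) / 2 * p := by gcongr
            _ = 1 / 2 := by field_simp
        have h5 : 1 + -p = Function.leftLim G x := by rw [hp']; ring
        rw [h5] at this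
        linarith
      have h4 : (1 / p) / 2 * (G x - Function.leftLim G x) * (1 / 2) ≤ (1 - a) / 16 := by
        refine le_trans ?_ (h1.trans h2)
        gcongr
      have h5 : (G x - Function.leftLim G x) / p ≤ (1 - a) / 4 := by
        have : (1 / p) / 2 * (G x - Function.leftLim G x) * (1 / 2)
          = ((G x - Function.leftLim G x) / p) / 4 := by field_simp; ring
        linarith
      have h6 : (1 - G x) / p = 1 - (G x - Function.leftLim G x) / p := by
        field_simp; rw [hp']; ring
      rw [h6]
      linarith
    · filter_upwards [hG.eventually_lt_one] with x hx
      have hle := hG.monotone.leftLim_le (le_refl x)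
      refine lt_of_le_of_lt ?_ ha
      rw [div_le_one (by linarith)]
      linarith
  simpa using key.inv₀ one_ne_zero

/-! ### Comparison of powers for tail-equivalent distribution functions -/

/-- For `y ≤ x` the factor `n + 1` is absorbed: `(n + 1)(1 - x) x^n ≤ 1 - x^(n+1) ≤ 1`, which makes
the bound uniform in `n`. -/
theorem pow_sub_pow_le_of_one_sub_le {x y ε : ℝ} (hx0 : 0 ≤ x) (hy : 0 ≤ y) (hx : x ≤ 1)
    (hε : 0 ≤ ε)
    (h : 1 - y ≤ (1 + ε) * (1 - x)) (n : ℕ) : x ^ n - y ^ n ≤ ε := by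
  rcases le_total x y with hxy | hxy
  · linarith [pow_le_pow_left₀ hx0 hxy n]
  · cases n with
    | zero => simpa
    | succ n =>
      have h1 := pow_sub_pow_le_succ_mul_sub_mul_pow hy hxy n
      have h2 := succ_mul_sub_mul_pow_le_pow_sub_pow hx0 hx n
      have h3 : ((n : ℝ) + 1) * (1 - x) * x ^ n ≤ 1 := by
        have := pow_nonneg hx0 (n + 1)
        rw [one_pow] at h2
        linarith
      calc x ^ (n + 1) - y ^ (n + 1) ≤ (n + 1) * (x - y) * x ^ n := h1
        _ ≤ (n + 1) * (ε * (1 - x)) * x ^ n := by gcongr; linarith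
        _ = ε * (((n : ℝ) + 1) * (1 - x) * x ^ n) := by ring
        _ ≤ ε * 1 := by gcongr
        _ = ε := mul_one ε

theorem tendsto_pow_sub_pow_of_tail {G H : ℝ → ℝ} (hG : IsDistributionFunction G)
    (hH : IsDistributionFunction H)
    (h : ∀ ε > 0, ∃ a, G a < 1 ∧ H a < 1 ∧ ∀ x, a ≤ x →
      1 - G x ≤ (1 + ε) * (1 - H x) ∧ 1 - H x ≤ (1 + ε) * (1 - G x)) (u : ℕ → ℝ) :
    Tendsto (fun n => H (u n) ^ n - G (u n) ^ n) atTop (𝓝 0) := by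
  refine Metric.tendsto_nhds.2 fun ε hε => ?_
  obtain ⟨a, hGa, hHa, ha⟩ := h (ε / 2) (by positivity)
  -- Left of `a` both powers vanish, by monotonicity; right of `a` the tail comparison applies.
  have h1 := (tendsto_pow_atTop_nhds_zero_of_lt_one (hG.nonneg a) hGa).eventually (gt_mem_nhds hε)
  have h2 := (tendsto_pow_atTop_nhds_zero_of_lt_one (hH.nonneg a) hHa).eventually (gt_mem_nhds hε)
  filter_upwards [h1, h2] with n h1 h2
  rw [dist_zero_right, Real.norm_eq_abs, abs_lt]
  rcases le_total a (u n) with hu | hu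
  · have h3 := pow_sub_pow_le_of_one_sub_le (hH.nonneg _) (hG.nonneg (u n)) (hH.le_one _) (by positivity)
      (ha _ hu).1 n
    have h4 := pow_sub_pow_le_of_one_sub_le (hG.nonneg _) (hH.nonneg (u n)) (hG.le_one _) (by positivity)
      (ha _ hu).2 n
    constructor <;> linarith
  · have h3 := pow_le_pow_left₀ (hG.nonneg _) (hG.monotone hu) n
    have h4 := pow_le_pow_left₀ (hH.nonneg _) (hH.monotone hu) n
    have h5 := pow_nonneg (hG.nonneg (u n)) n
    have h6 := pow_nonneg (hH.nonneg (u n)) n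
    constructor <;> linarith

/-! ### Continuous interpolation of a regular distribution function -/

/-- The piecewise linear function that is `0` left of `a` and `1` right of `b`. -/
noncomputable def ramp (a b x : ℝ) : ℝ :=
  max 0 (min 1 ((x - a) / (b - a)))

theorem continuous_ramp (a b : ℝ) : Continuous (ramp a b) := by
  unfold ramp
  fun_prop

theorem ramp_nonneg (a b x : ℝ) : 0 ≤ ramp a b x := le_max_left _ _

theorem ramp_le_one (a b x : ℝ) : ramp a b x ≤ 1 := max_le zero_le_one (min_le_left _ _)

theorem monotone_ramp {a b : ℝ} (hab : a < b) : Monotone (ramp a b) := fun x y hxy => by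
  have : 0 < b - a := sub_pos.2 hab
  unfold ramp
  gcongr

theorem ramp_of_le {a b x : ℝ} (hab : a < b) (hx : x ≤ a) : ramp a b x = 0 :=
  max_eq_left ((min_le_right _ _).trans
    (div_nonpos_of_nonpos_of_nonneg (sub_nonpos.2 hx) (sub_pos.2 hab).le))

theorem ramp_of_ge {a b x : ℝ} (hab : a < b) (hx : b ≤ x) : ramp a b x = 1 := by
  have : 1 ≤ (x - a) / (b - a) := by
    rw [one_le_div (sub_pos.2 hab)]
    linarith
  rw [ramp, min_eq_left this, max_eq_right zero_le_one]

/-- Prescribed values at an increasing sequence of points are taken by a continuous distribution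
function. -/
theorem exists_continuous_isDistributionFunction {b g : ℕ → ℝ} (hb : StrictMono b)
    (hg : Monotone g) (hg0 : g 0 = 0) (hg1 : Tendsto g atTop (𝓝 1)) :
    ∃ G : ℝ → ℝ, Continuous G ∧ IsDistributionFunction G ∧ ∀ k, G (b k) = g k := by
  have hw : ∀ k, 0 ≤ g (k + 1) - g k := fun k => sub_nonneg.2 (hg k.le_succ)
  have hsum : HasSum (fun k => g (k + 1) - g k) 1 := by
    rw [hasSum_iff_tendsto_nat_of_nonneg hw]
    simpa only [Finset.sum_range_sub, hg0, sub_zero] using hg1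
  have hlt : ∀ k, b k < b (k + 1) := fun k => hb k.lt_succ_self
  have hle : ∀ k x, (g (k + 1) - g k) * ramp (b k) (b (k + 1)) x ≤ g (k + 1) - g k := fun k x =>
    mul_le_of_le_one_right (hw k) (ramp_le_one _ _ _)
  have hnn : ∀ k x, 0 ≤ (g (k + 1) - g k) * ramp (b k) (b (k + 1)) x := fun k x =>
    mul_nonneg (hw k) (ramp_nonneg _ _ _)
  have hs : ∀ x, Summable fun k => (g (k + 1) - g k) * ramp (b k) (b (k + 1)) x := fun x =>
    hsum.summable.of_nonneg_of_le (fun k => hnn k x) (fun k => hle k x)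
  -- Each increment of `g` is spread linearly over its interval; the increments sum to 1 and
  -- dominate the series uniformly.
  let G : ℝ → ℝ := fun x => ∑' k, (g (k + 1) - g k) * ramp (b k) (b (k + 1)) x
  have hcont : Continuous G := by
    refine continuous_tsum (fun k => continuous_const.mul (continuous_ramp _ _)) hsum.summable
      fun k x => ?_
    rw [Real.norm_of_nonneg (hnn k x)]
    exact hle k x
  have hmono : Monotone G := fun x y hxy => (hs x).tsum_le_tsum
    (fun k => mul_le_mul_of_nonneg_left (monotone_ramp (hlt k) hxy) (hw k)) (hs y)
  have hval : ∀ m, G (b m) = g m := by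
    intro m
    have h1 : G (b m) = ∑ k ∈ Finset.range m, (g (k + 1) - g k) * ramp (b k) (b (k + 1)) (b m) := by
      refine tsum_eq_sum fun k hk => ?_
      rw [ramp_of_le (hlt k) (hb.monotone (by simpa using hk)), mul_zero]
    rw [h1, ← sub_zero (g m), ← hg0, ← Finset.sum_range_sub]
    refine Finset.sum_congr rfl fun k hk => ?_
    rw [ramp_of_ge (hlt k) (hb.monotone (Nat.succ_le_of_lt (Finset.mem_range.1 hk))), mul_one]
  have hone : ∀ x, G x ≤ 1 := fun x => ((hs x).tsum_le_tsum (fun k => hle k x) hsum.summable).trans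
    hsum.tsum_eq.le
  refine ⟨G, hcont, ⟨hmono, fun x => hcont.continuousWithinAt, ?_, ?_⟩, hval⟩
  · refine tendsto_const_nhds.congr' ?_
    filter_upwards [eventually_le_atBot (b 0)] with x hx
    have h1 := hmono hx
    rw [hval, hg0] at h1
    exact le_antisymm (tsum_nonneg fun k => hnn k x) h1
  · refine tendsto_order.2 ⟨fun a ha => ?_, fun a ha => Eventually.of_forall fun x =>
      (hone x).trans_lt ha⟩
    obtain ⟨k, hk⟩ := (hg1.eventually (lt_mem_nhds ha)).exists
    filter_upwards [eventually_ge_atTop (b k)] with x hx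
    rw [← hval] at hk
    exact hk.trans_le (hmono hx)

/-- Beyond any point left of the right end there is another one, at which the reciprocal of the
tail has increased by at least one, and by at most one before the last jump. -/
theorem IsRegularDF.exists_next {G : ℝ → ℝ} (hG : IsRegularDF G) {x : ℝ} (hx : G x < 1) :
    ∃ y, x < y ∧ G y < 1 ∧ 1 / (1 - G x) + 1 ≤ 1 / (1 - G y) ∧
      1 / (1 - Function.leftLim G y) ≤ 1 / (1 - G x) + 1 := by
  have hd := hG.isDistributionFunction
  have hx0 : 0 < 1 - G x := sub_pos.2 hx
  -- the level to be reached
  obtain ⟨l, hl1, hl⟩ : ∃ l, l < 1 ∧ 1 / (1 - l) = 1 / (1 - G x) + 1 := by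
    refine ⟨1 - 1 / (1 / (1 - G x) + 1), ?_, ?_⟩
    · have : 0 < 1 / (1 / (1 - G x) + 1) := by positivity
      linarith
    · rw [sub_sub_cancel, one_div_one_div]
  have hiff : ∀ {t}, t < 1 → (1 / (1 - l) ≤ 1 / (1 - t) ↔ l ≤ t) := fun {t} ht => by
    rw [one_div_le_one_div (by linarith) (by linarith), sub_le_sub_iff_left]
  have hxl : G x < l := by
    by_contra! hc
    have := (hiff hx).2 hc
    linarith
  let A := {y | l ≤ G y}
  have hbdd : BddBelow A := ⟨x, fun y hy => by
    by_contra! hc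
    exact absurd (hd.monotone hc.le) (not_le.2 (hxl.trans_le hy))⟩
  have hne : (toRightEnd G).NeBot := hd.hasBasis_toRightEnd.neBot_iff.2 fun {a} ha => by
    obtain ⟨c, h1, h2⟩ := EReal.lt_iff_exists_real_btwn.1 ((hd.coe_lt_rightEnd_iff a).2 ha)
    exact ⟨c, EReal.coe_lt_coe_iff.1 h1, (hd.coe_lt_rightEnd_iff c).1 h2⟩
  -- `G(G_*-) = 1` is what allows level `l` to be exceeded before the right end, so that the
  -- generalized inverse `sInf A` of `l` still satisfies `G < 1`.
  obtain ⟨z, hzl, hz1⟩ :=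
    ((hG.tendsto_one.eventually (lt_mem_nhds hl1)).and hd.eventually_lt_one).exists
  have hzA : z ∈ A := hzl.le
  have hyl : l ≤ G (sInf A) := by
    have h1 : Tendsto G (𝓝[>] sInf A) (𝓝 (G (sInf A))) :=
      (hd.rightContinuous _).mono Set.Ioi_subset_Ici_self
    refine ge_of_tendsto h1 ?_
    filter_upwards [self_mem_nhdsWithin] with y hy
    obtain ⟨w, hw, hwy⟩ := exists_lt_of_csInf_lt ⟨z, hzA⟩ hy
    exact le_trans hw (hd.monotone hwy.le)
  have hy1 : G (sInf A) < 1 := (hd.monotone (csInf_le hbdd hzA)).trans_lt hz1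
  have hleft : Function.leftLim G (sInf A) ≤ l := by
    refine le_of_tendsto (hd.monotone.tendsto_leftLim _) ?_
    filter_upwards [self_mem_nhdsWithin] with y hy
    by_contra! hc
    exact absurd (csInf_le hbdd (show y ∈ A from hc.le)) (not_le.2 hy)
  refine ⟨sInf A, ?_, hy1, ?_, ?_⟩
  · by_contra! hc
    exact absurd (hd.monotone hc) (not_le.2 (hxl.trans_le hyl))
  · rw [← hl]
    exact (hiff hy1).2 hyl
  · rw [← hl]
    exact one_div_le_one_div_of_le (by linarith) (by linarith)

/-- A sequence increasing to the right end along which consecutive tails are equivalent. -/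
theorem IsRegularDF.exists_seq {G : ℝ → ℝ} (hG : IsRegularDF G) :
    ∃ a : ℕ → ℝ, StrictMono a ∧ (∀ k, G (a k) < 1) ∧ Tendsto (fun k => G (a k)) atTop (𝓝 1) ∧
      ∀ ε > 0, ∀ᶠ k in atTop, 1 - G (a k) ≤ (1 + ε) * (1 - G (a (k + 1))) := by
  have hd := hG.isDistributionFunction
  choose! next hn using fun x (hx : G x < 1) => hG.exists_next hx
  obtain ⟨x, hx⟩ := hd.exists_lt_one
  let a : ℕ → ℝ := fun k => next^[k] x
  have hsucc : ∀ k, a (k + 1) = next (a k) := fun k => Function.iterate_succ_apply' _ _ _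
  have ha1 : ∀ k, G (a k) < 1 := fun k => by
    induction k with
    | zero => exact hx
    | succ k ih => rw [hsucc]; exact (hn _ ih).2.1
  have hlt : ∀ k, a k < a (k + 1) := fun k => by rw [hsucc]; exact (hn _ (ha1 k)).1
  have hinc : ∀ k, 1 / (1 - G (a k)) + 1 ≤ 1 / (1 - G (a (k + 1))) := fun k => by
    rw [hsucc]; exact (hn _ (ha1 k)).2.2.1
  have hl : ∀ k, 1 / (1 - Function.leftLim G (a (k + 1))) ≤ 1 / (1 - G (a k)) + 1 := fun k => by
    rw [hsucc]; exact (hn _ (ha1 k)).2.2.2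
  have hge : ∀ k : ℕ, (k : ℝ) ≤ 1 / (1 - G (a k)) := fun k => by
    induction k with
    | zero => simpa using (ha1 0).le
    | succ k ih => push_cast; linarith [hinc k]
  have hT : Tendsto (fun k => 1 / (1 - G (a k))) atTop atTop :=
    tendsto_atTop_mono hge tendsto_natCast_atTop_atTop
  have h0 : Tendsto (fun k => 1 - G (a k)) atTop (𝓝 0) := by
    exact hT.inv_tendsto_atTop.congr fun k => by simp
  have h1 : Tendsto (fun k => G (a k)) atTop (𝓝 1) := by
    simpa using h0.const_sub 1
  have hmono : StrictMono a := strictMono_nat_of_lt_succ hlt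
  have hend : Tendsto a atTop (toRightEnd G) := by
    refine hd.hasBasis_toRightEnd.tendsto_right_iff.2 fun c hc => ?_
    filter_upwards [h1.eventually (lt_mem_nhds hc)] with k hk
    exact ⟨hd.monotone.reflect_lt hk, ha1 k⟩
  refine ⟨a, hmono, ha1, h1, fun ε hε => ?_⟩
  obtain ⟨δ, hδ, hδε⟩ : ∃ δ > 0, (1 + δ) * (1 + δ) ≤ 1 + ε := by
    refine ⟨min 1 (ε / 3), by positivity, ?_⟩
    have h2 := min_le_left 1 (ε / 3)
    have h3 := min_le_right 1 (ε / 3)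
    have h4 : 0 < min 1 (ε / 3) := by positivity
    nlinarith
  have hr := (hG.tendsto_ratio.comp (hend.comp (tendsto_add_atTop_nat 1))).eventually
    (gt_mem_nhds (show (1 : ℝ) < 1 + δ by linarith))
  have hs := h0.eventually (gt_mem_nhds hδ)
  filter_upwards [hr, hs] with k hr hs
  simp only [Function.comp_apply] at hr
  have p1 : 0 < 1 - G (a k) := sub_pos.2 (ha1 k)
  have p2 : 0 < 1 - G (a (k + 1)) := sub_pos.2 (ha1 (k + 1))
  have p3 : 0 < 1 - Function.leftLim G (a (k + 1)) := by
    have := hd.monotone.leftLim_le (le_refl (a (k + 1)))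
    linarith
  rw [div_lt_iff₀ p2] at hr
  -- A unit increase of the reciprocal multiplies it by `1 + (1 - G (a k))`, a factor tending to 1.
  -- Regularity then crosses the jump at `a (k + 1)`.
  have e1 : 1 - G (a k) ≤ (1 + (1 - G (a k))) * (1 - Function.leftLim G (a (k + 1))) := by
    have := hl k
    rw [div_add_one p1.ne', div_le_div_iff₀ p3 p1] at this
    linarith
  calc 1 - G (a k) ≤ (1 + (1 - G (a k))) * (1 - Function.leftLim G (a (k + 1))) := e1
    _ ≤ (1 + δ) * ((1 + δ) * (1 - G (a (k + 1)))) := by gcongr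
    _ = (1 + δ) * (1 + δ) * (1 - G (a (k + 1))) := by ring
    _ ≤ (1 + ε) * (1 - G (a (k + 1))) := by gcongr

/-- Interpolate at the points of `exists_seq`: between neighbours both tails are squeezed between
the same two values, whose ratio tends to 1. -/
theorem IsRegularDF.exists_continuous_tail {G : ℝ → ℝ} (hG : IsRegularDF G) :
    ∃ H : ℝ → ℝ, Continuous H ∧ IsDistributionFunction H ∧
      ∀ ε > 0, ∃ a, G a < 1 ∧ H a < 1 ∧ ∀ x, a ≤ x →
        1 - G x ≤ (1 + ε) * (1 - H x) ∧ 1 - H x ≤ (1 + ε) * (1 - G x) := by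
  have hd := hG.isDistributionFunction
  obtain ⟨a, hmono, ha1, ht, hε⟩ := hG.exists_seq
  -- An extra node left of `a 0` carries the value 0.
  let b : ℕ → ℝ := fun k => Nat.casesOn k (a 0 - 1) a
  let g : ℕ → ℝ := fun k => Nat.casesOn k 0 fun k => G (a k)
  have hb : StrictMono b := strictMono_nat_of_lt_succ fun k => by
    cases k with
    | zero => exact sub_one_lt _
    | succ k => exact hmono k.lt_succ_self
  have hg : Monotone g := monotone_nat_of_le_succ fun k => by
    cases k with
    | zero => exact hd.nonneg _
    | succ k => exact hd.monotone (hmono k.lt_succ_self).le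
  have hg1 : Tendsto g atTop (𝓝 1) := (tendsto_add_atTop_iff_nat 1).1 ht
  obtain ⟨H, hHc, hH, hval⟩ := exists_continuous_isDistributionFunction hb hg rfl hg1
  have hval' : ∀ k, H (a k) = G (a k) := fun k => hval (k + 1)
  refine ⟨H, hHc, hH, fun ε hpos => ?_⟩
  obtain ⟨K, hK⟩ := eventually_atTop.1 (hε ε hpos)
  refine ⟨a K, ha1 K, by rw [hval']; exact ha1 K, fun x hx => ?_⟩
  by_cases hex : ∃ k, x < a k
  · classical
    obtain ⟨k, hk, hkx, hxk⟩ : ∃ k, K ≤ k ∧ a k ≤ x ∧ x < a (k + 1) := by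
      have hspec := Nat.find_spec hex
      have hKlt : K < Nat.find hex := hmono.lt_iff_lt.1 (hx.trans_lt hspec)
      obtain ⟨k, hk⟩ : ∃ k, Nat.find hex = k + 1 := Nat.exists_eq_add_one.2 (by omega)
      refine ⟨k, by omega, not_lt.1 (Nat.find_min hex (by omega)), ?_⟩
      rw [← hk]
      exact hspec
    have h1 := hd.monotone hkx
    have h2 := hd.monotone hxk.le
    have h3 := hH.monotone hkx
    have h4 := hH.monotone hxk.le
    rw [hval'] at h3 h4
    have h5 := hK k hk
    have h6 : (1 + ε) * (1 - G (a (k + 1))) ≤ (1 + ε) * (1 - H x) := by gcongr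
    have h7 : (1 + ε) * (1 - G (a (k + 1))) ≤ (1 + ε) * (1 - G x) := by gcongr
    constructor <;> linarith
  -- `x` lies beyond all nodes, possible when the right end is finite.
  · push Not at hex
    have h1 : G x = 1 := le_antisymm (hd.le_one x)
      (le_of_tendsto ht (Eventually.of_forall fun k => hd.monotone (hex k)))
    have h2 : H x = 1 := le_antisymm (hH.le_one x)
      (le_of_tendsto ht (Eventually.of_forall fun k => by rw [← hval']; exact hH.monotone (hex k)))
    simp [h1, h2]

/-! ### Maxima over cycles -/

theorem maxOver_le_iff {s : Finset ℕ} (hs : s.Nonempty) {f : ℕ → ℝ} {u : ℝ} :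
    maxOver s f ≤ u ↔ ∀ j ∈ s, f j ≤ u := by
  rw [maxOver, dif_pos hs, Finset.sup'_le_iff]

theorem exists_le_mem_cycle {Ω : Type*} {S : ℕ → Ω → ℕ} {m j : ℕ} {ω : Ω}
    (hj : j < S m ω) : ∃ k ≤ m, cycleStart S k ω ≤ j ∧ j < S k ω := by
  induction m with
  | zero => exact ⟨0, le_rfl, Nat.zero_le _, hj⟩
  | succ m ih =>
    by_cases hm : j < S m ω
    · obtain ⟨k, hk, h1⟩ := ih hm
      exact ⟨k, hk.trans m.le_succ, h1⟩
    · exact ⟨m + 1, le_rfl, not_lt.1 hm, hj⟩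

section Regenerative

variable {Ω : Type*} [MeasurableSpace Ω] {P : Measure Ω} {X : ℕ → Ω → ℝ} {S : ℕ → Ω → ℕ}

theorem IsRegenerative.cycleStart_lt (h : IsRegenerative P X S) (k : ℕ) (ω : Ω) :
    cycleStart S k ω < S k ω := by
  cases k with
  | zero => exact h.time_pos ω
  | succ k => exact h.time_lt k ω

theorem IsRegenerative.strictMono_time (h : IsRegenerative P X S) (ω : Ω) :
    StrictMono (fun k => S k ω) :=
  strictMono_nat_of_lt_succ fun k => h.time_lt k ω

theorem IsRegenerative.cycleMax_le_iff (h : IsRegenerative P X S) {k : ℕ} {ω : Ω} {u : ℝ} :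
    cycleMax X S k ω ≤ u ↔ ∀ j, cycleStart S k ω ≤ j → j < S k ω → X j ω ≤ u := by
  rw [cycleMax, maxOver_le_iff (Finset.nonempty_Ico.2 (h.cycleStart_lt k ω))]
  simp only [Finset.mem_Ico, and_imp]

/-- Cycles `1, …, m` occupy the indices from `S_0 ≥ 1` to `S_m - 1 ≤ n`, all seen by `M_n`. -/
theorem IsRegenerative.maxOver_cycleMax_le (h : IsRegenerative P X S) {m n : ℕ} (hm : 1 ≤ m)
    {ω : Ω} {u : ℝ} (hS : S m ω ≤ n + 1) (hu : partialMax X n ω ≤ u) :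
    maxOver (Finset.Icc 1 m) (fun k => cycleMax X S k ω) ≤ u := by
  have hmono := (h.strictMono_time ω).monotone
  -- `S_m ≥ 2`, so `M_n` is not the default value 0 of an empty maximum.
  have hn : 1 ≤ n := by
    have h1 := h.time_pos ω
    have h2 := h.strictMono_time ω (show 0 < m from hm)
    simp only at h2
    omega
  rw [partialMax, maxOver_le_iff (Finset.nonempty_Icc.2 hn)] at hu
  rw [maxOver_le_iff (Finset.nonempty_Icc.2 hm)]
  intro k hk
  rw [Finset.mem_Icc] at hk
  rw [h.cycleMax_le_iff]
  intro j hj hj'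
  obtain ⟨k, rfl⟩ := Nat.exists_eq_add_one.2 hk.1
  have h1 : 0 < S k ω := (h.time_pos ω).trans_le (hmono k.zero_le)
  have h2 : S (k + 1) ω ≤ S m ω := hmono hk.2
  have h3 : S k ω ≤ j := hj
  exact hu j (Finset.mem_Icc.2 ⟨by omega, by omega⟩)

theorem IsRegenerative.partialMax_le (h : IsRegenerative P X S) {m n : ℕ} (hm : 1 ≤ m) (hn : 1 ≤ n)
    {ω : Ω} {u : ℝ} (hS : n < S m ω)
    (h0 : cycleMax X S 0 ω ≤ maxOver (Finset.Icc 1 m) (fun k => cycleMax X S k ω))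
    (hu : maxOver (Finset.Icc 1 m) (fun k => cycleMax X S k ω) ≤ u) : partialMax X n ω ≤ u := by
  rw [partialMax, maxOver_le_iff (Finset.nonempty_Icc.2 hn)]
  intro j hj
  obtain ⟨k, hk, h1, h2⟩ := exists_le_mem_cycle (S := S) (m := m) (j := j) (ω := ω)
    ((Finset.mem_Icc.1 hj).2.trans_lt hS)
  refine h.cycleMax_le_iff.1 ?_ j h1 h2
  rcases Nat.eq_zero_or_pos k with rfl | hk0
  · exact h0.trans hu
  · exact (maxOver_le_iff (Finset.nonempty_Icc.2 hm)).1 hu k (Finset.mem_Icc.2 ⟨hk0, hk⟩)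

theorem IsRegenerative.isDistributionFunction_cycleMaxDF [IsProbabilityMeasure P]
    (h : IsRegenerative P X S) : IsDistributionFunction (cycleMaxDF P X S) := by
  have hY : AEMeasurable (cycleMax X S 1) P :=
    measurable_snd.comp_aemeasurable (h.identDistrib 1 le_rfl).aemeasurable_fst
  have := Measure.isProbabilityMeasure_map hY
  have hF : cycleMaxDF P X S = cdf (P.map (cycleMax X S 1)) := by
    ext x
    rw [cdf_eq_real, map_measureReal_apply_of_aemeasurable hY measurableSet_Iic]
    rfl
  rw [hF]
  exact ⟨monotone_cdf _, fun x => (cdf _).right_continuous x, tendsto_cdf_atBot _,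
    tendsto_cdf_atTop _⟩

theorem IsRegenerative.measureReal_maxOver_cycleMax_le [IsProbabilityMeasure P]
    (h : IsRegenerative P X S) {m : ℕ} (hm : 1 ≤ m) (u : ℝ) :
    P.real {ω | maxOver (Finset.Icc 1 m) (fun k => cycleMax X S k ω) ≤ u} =
      cycleMaxDF P X S u ^ m := by
  have hs : MeasurableSet {p : ℕ × ℝ | p.2 ≤ u} := measurableSet_le measurable_snd measurable_const
  have h1 := h.indep.measure_inter_preimage_eq_mul (Finset.Icc 1 m)
    (sets := fun _ => {p : ℕ × ℝ | p.2 ≤ u}) (fun _ _ => hs)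
  have h2 : {ω | maxOver (Finset.Icc 1 m) (fun k => cycleMax X S k ω) ≤ u} =
      ⋂ k ∈ Finset.Icc 1 m, (fun ω => (cycleLength S k ω, cycleMax X S k ω)) ⁻¹'
        {p : ℕ × ℝ | p.2 ≤ u} := by
    ext ω
    simp [maxOver_le_iff (Finset.nonempty_Icc.2 hm)]
  rw [h2, Measure.real, h1, ENNReal.toReal_prod]
  have h3 : ∀ k ∈ Finset.Icc 1 m, (P ((fun ω => (cycleLength S k ω, cycleMax X S k ω)) ⁻¹'
        {p : ℕ × ℝ | p.2 ≤ u})).toReal = cycleMaxDF P X S u := fun k hk => by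
    rw [(h.identDistrib k (Finset.mem_Icc.1 hk).1).measure_mem_eq hs]
    rfl
  rw [Finset.prod_congr rfl h3]
  simp

/-! ### The law of large numbers for the regeneration times -/

theorem IsRegenerative.time_eq (h : IsRegenerative P X S) (m : ℕ) (ω : Ω) :
    (S m ω : ℝ) = S 0 ω + ∑ i ∈ Finset.range m, (cycleLength S (i + 1) ω : ℝ) := by
  induction m with
  | zero => simp
  | succ m ih =>
    rw [Finset.sum_range_succ, ← add_assoc, ← ih, cycleLength, cycleStart,
      Nat.cast_sub (h.time_lt m ω).le]
    ring

theorem IsRegenerative.one_le_meanCycleLength [IsProbabilityMeasure P] (h : IsRegenerative P X S)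
    (hint : Integrable (fun ω => (cycleLength S 1 ω : ℝ)) P) : 1 ≤ meanCycleLength P S := by
  have h1 : ∀ ω, (1 : ℝ) ≤ cycleLength S 1 ω := fun ω => by
    have := h.cycleStart_lt 1 ω
    have : 1 ≤ cycleLength S 1 ω := by unfold cycleLength; omega
    exact_mod_cast this
  have h2 := integral_mono (integrable_const (1 : ℝ)) hint h1
  rw [integral_const, probReal_univ, one_smul] at h2
  exact h2

theorem IsRegenerative.tendsto_time_div [IsProbabilityMeasure P] (h : IsRegenerative P X S)
    (hint : Integrable (fun ω => (cycleLength S 1 ω : ℝ)) P) :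
    ∀ᵐ ω ∂P, Tendsto (fun m : ℕ => (S m ω : ℝ) / m) atTop (𝓝 (meanCycleLength P S)) := by
  have hfst : Measurable (fun p : ℕ × ℝ => (p.1 : ℝ)) := by fun_prop
  have hlaw := strong_law_ae_real (μ := P) (fun i ω => (cycleLength S (i + 1) ω : ℝ)) hint
    (fun i j hij => (h.indep.indepFun (i := i + 1) (j := j + 1) (by simpa using hij)).comp
      hfst hfst)
    (fun i => (h.identDistrib (i + 1) (by omega)).comp hfst)
  filter_upwards [hlaw] with ω hω
  have h0 : Tendsto (fun m : ℕ => (S 0 ω : ℝ) / m) atTop (𝓝 0) :=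
    tendsto_const_div_atTop_nhds_zero_nat _
  have h1 := h0.add hω
  rw [zero_add] at h1
  refine h1.congr fun m => ?_
  rw [h.time_eq m ω, add_div]

theorem IsRegenerative.tendsto_measureReal_abs_time_div [IsProbabilityMeasure P]
    (h : IsRegenerative P X S) (hint : Integrable (fun ω => (cycleLength S 1 ω : ℝ)) P)
    {δ : ℝ} (hδ : 0 < δ) :
    Tendsto (fun m : ℕ => P.real {ω | δ ≤ |(S m ω : ℝ) / m - meanCycleLength P S|}) atTop
      (𝓝 0) := by
  have h1 : TendstoInMeasure P (fun m ω => (S m ω : ℝ) / m) atTop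
      (fun _ => meanCycleLength P S) := by
    refine tendstoInMeasure_of_tendsto_ae (fun m => ?_) (h.tendsto_time_div hint)
    have := h.measurable_time m
    exact Measurable.aestronglyMeasurable (by fun_prop)
  have h2 := tendstoInMeasure_iff_measureReal_norm.1 h1 δ hδ
  simpa only [Real.norm_eq_abs] using h2

/-! ### The cycle maximum determines a phantom distribution function -/

theorem IsRegenerative.eventually_measureReal_le [IsProbabilityMeasure P]
    (h : IsRegenerative P X S) (hint : Integrable (fun ω => (cycleLength S 1 ω : ℝ)) P)
    {ε : ℝ} (hε : 0 < ε) :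
    ∀ᶠ n : ℕ in atTop, ∀ u, P.real {ω | partialMax X n ω ≤ u} ≤
      (cycleMaxDF P X S u ^ (1 / meanCycleLength P S)) ^ n + ε := by
  have hF := h.isDistributionFunction_cycleMaxDF
  have hμ := h.one_le_meanCycleLength hint
  set μ := meanCycleLength P S with hμd
  obtain ⟨δ, hδ, hδε⟩ : ∃ δ > 0, δ < ε / 2 := ⟨ε / 4, by positivity, by linarith⟩
  have hc : 0 < μ * (1 + δ) := by positivity
  -- With this many cycles, `S_m > n + 1` forces `S_m / m` to exceed `μ` by at least `μ δ`. Rounding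
  -- costs the term `μ / n` below.
  have hm : Tendsto (fun n : ℕ => ⌊(n : ℝ) / (μ * (1 + δ))⌋₊) atTop atTop :=
    tendsto_nat_floor_atTop.comp (tendsto_natCast_atTop_atTop.atTop_div_const hc)
  have hS := ((h.tendsto_measureReal_abs_time_div hint (δ := μ * δ) (by positivity)).comp
    hm).eventually (gt_mem_nhds (show 0 < ε / 2 by positivity))
  have hlim : Tendsto (fun n : ℕ => δ + μ / n) atTop (𝓝 (δ + 0)) :=
    (tendsto_const_div_atTop_nhds_zero_nat μ).const_add δ
  rw [add_zero] at hlim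
  filter_upwards [hS, hm.eventually_ge_atTop 1, eventually_gt_atTop 0,
    hlim.eventually (gt_mem_nhds hδε)] with n hS hm hn hd u
  simp only [Function.comp_apply] at hS
  set m := ⌊(n : ℝ) / (μ * (1 + δ))⌋₊ with hmd
  have hn' : (0 : ℝ) < n := by exact_mod_cast hn
  have hm' : (0 : ℝ) < m := by exact_mod_cast hm
  have hmn : (m : ℝ) * (μ * (1 + δ)) ≤ n := by
    rw [← le_div_iff₀ hc]; exact Nat.floor_le (by positivity)
  have hnm : (n : ℝ) < (m + 1) * (μ * (1 + δ)) := by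
    rw [← div_lt_iff₀ hc]; exact Nat.lt_floor_add_one _
  have hsub : {ω | partialMax X n ω ≤ u} ⊆
      {ω | maxOver (Finset.Icc 1 m) (fun k => cycleMax X S k ω) ≤ u} ∪
        {ω | μ * δ ≤ |(S m ω : ℝ) / m - μ|} := by
    intro ω hω
    by_cases hc' : S m ω ≤ n + 1
    · exact Or.inl (h.maxOver_cycleMax_le hm hc' hω)
    · right
      rw [Set.mem_ofPred_eq]
      refine le_trans ?_ (le_abs_self _)
      have : (n : ℝ) + 1 < S m ω := by exact_mod_cast not_le.1 hc'
      rw [le_sub_iff_add_le, le_div_iff₀ hm']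
      linarith
  have h1 := (measureReal_mono hsub).trans (measureReal_union_le (μ := P) _ _)
  rw [h.measureReal_maxOver_cycleMax_le hm] at h1
  have hF0 := hF.nonneg u
  have h2 : cycleMaxDF P X S u ^ m - (cycleMaxDF P X S u ^ (1 / μ)) ^ n ≤ ε / 2 := by
    rw [← Real.rpow_natCast, ← Real.rpow_natCast, ← Real.rpow_mul hF0]
    refine (rpow_sub_rpow_le hF0 hm'.le (by positivity) ?_).trans ?_
    · rw [one_div_mul_eq_div, le_div_iff₀ (by positivity)]
      have : 0 ≤ (m : ℝ) * μ * δ := by positivity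
      linarith
    · have e : (m : ℝ) / (1 / μ * n) = m * μ / n := by field_simp
      rw [e]
      refine le_trans ?_ hd.le
      rw [sub_le_iff_le_add, ← sub_le_iff_le_add', le_div_iff₀ hn']
      have e2 : (1 - (δ + μ / n)) * n = n - δ * n - μ := by field_simp; ring
      rw [e2]
      have : (n : ℝ) - δ * n ≤ n / (1 + δ) := by
        rw [le_div_iff₀ (by positivity)]
        nlinarith [mul_pos hδ hn', mul_pos (mul_pos hδ hδ) hn']
      have : (n : ℝ) / (1 + δ) < (m + 1) * μ := by
        rw [div_lt_iff₀ (by positivity)]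
        linarith
      linarith
  linarith

theorem IsRegenerative.eventually_le_measureReal [IsProbabilityMeasure P]
    (h : IsRegenerative P X S) (hint : Integrable (fun ω => (cycleLength S 1 ω : ℝ)) P)
    (hzero : Tendsto
      (fun n : ℕ => P.real {ω |
        maxOver (Finset.Icc 1 n) (fun j => cycleMax X S j ω) < cycleMax X S 0 ω})
      atTop (𝓝 0)) {ε : ℝ} (hε : 0 < ε) :
    ∀ᶠ n : ℕ in atTop, ∀ u, (cycleMaxDF P X S u ^ (1 / meanCycleLength P S)) ^ n ≤
      P.real {ω | partialMax X n ω ≤ u} + ε := by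
  have hF := h.isDistributionFunction_cycleMaxDF
  have hμ := h.one_le_meanCycleLength hint
  set μ := meanCycleLength P S with hμd
  obtain ⟨δ, hδ, hδε, hδ1⟩ : ∃ δ > 0, δ < ε / 3 ∧ δ < 1 :=
    ⟨min (ε / 3) 1 / 2, by positivity,
      by linarith [min_le_left (ε / 3) 1, lt_min (show 0 < ε / 3 by positivity) one_pos],
      by linarith [min_le_right (ε / 3) 1]⟩
  have hδ' : 0 < 1 - δ := by linarith
  have hc : 0 < μ * (1 - δ) := by positivity
  -- Now `n < m μ (1 - δ)`, so `S_m ≤ n` is a deviation of at least `μ δ`. The three thirds of `ε`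
  -- pay for this, for the initial cycle and for the exponent.
  have hm : Tendsto (fun n : ℕ => ⌊(n : ℝ) / (μ * (1 - δ))⌋₊ + 1) atTop atTop :=
    (tendsto_add_atTop_nat 1).comp
      (tendsto_nat_floor_atTop.comp (tendsto_natCast_atTop_atTop.atTop_div_const hc))
  have hS := ((h.tendsto_measureReal_abs_time_div hint (δ := μ * δ) (by positivity)).comp
    hm).eventually (gt_mem_nhds (show 0 < ε / 3 by positivity))
  have hZ := (hzero.comp hm).eventually (gt_mem_nhds (show 0 < ε / 3 by positivity))
  have hlim : Tendsto (fun n : ℕ => δ + μ / n) atTop (𝓝 (δ + 0)) :=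
    (tendsto_const_div_atTop_nhds_zero_nat μ).const_add δ
  rw [add_zero] at hlim
  filter_upwards [hS, hZ, eventually_gt_atTop 0,
    hlim.eventually (gt_mem_nhds hδε)] with n hS hZ hn hd u
  simp only [Function.comp_apply] at hS hZ
  have hm : 1 ≤ ⌊(n : ℝ) / (μ * (1 - δ))⌋₊ + 1 := by omega
  have hn' : (0 : ℝ) < n := by exact_mod_cast hn
  have hmn : (((⌊(n : ℝ) / (μ * (1 - δ))⌋₊ + 1 : ℕ) : ℝ) - 1) * (μ * (1 - δ)) ≤ n := by
    rw [← le_div_iff₀ hc]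
    push_cast
    rw [add_sub_cancel_right]
    exact Nat.floor_le (by positivity)
  have hnm : (n : ℝ) < ((⌊(n : ℝ) / (μ * (1 - δ))⌋₊ + 1 : ℕ) : ℝ) * (μ * (1 - δ)) := by
    rw [← div_lt_iff₀ hc]
    push_cast
    exact Nat.lt_floor_add_one _
  generalize ⌊(n : ℝ) / (μ * (1 - δ))⌋₊ + 1 = m at hS hZ hm hmn hnm
  have hm' : (0 : ℝ) < m := by exact_mod_cast hm
  have hsub : {ω | maxOver (Finset.Icc 1 m) (fun k => cycleMax X S k ω) ≤ u} ⊆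
      {ω | partialMax X n ω ≤ u} ∪
        ({ω | μ * δ ≤ |(S m ω : ℝ) / m - μ|} ∪
          {ω | maxOver (Finset.Icc 1 m) (fun j => cycleMax X S j ω) < cycleMax X S 0 ω}) := by
    intro ω hω
    by_cases hc' : n < S m ω
    · by_cases hz : cycleMax X S 0 ω ≤ maxOver (Finset.Icc 1 m) (fun k => cycleMax X S k ω)
      · exact Or.inl (h.partialMax_le hm hn hc' hz hω)
      · exact Or.inr (Or.inr (not_le.1 hz))
    · right; left
      rw [Set.mem_ofPred_eq]
      refine le_trans ?_ (neg_le_abs _)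
      have : (S m ω : ℝ) ≤ n := by exact_mod_cast not_lt.1 hc'
      have : (S m ω : ℝ) / m ≤ μ * (1 - δ) := by
        rw [div_le_iff₀ hm']
        linarith
      linarith
  have h1 := (measureReal_mono hsub).trans (measureReal_union_le (μ := P) _ _)
  have h1' := measureReal_union_le (μ := P) {ω | μ * δ ≤ |(S m ω : ℝ) / m - μ|}
    {ω | maxOver (Finset.Icc 1 m) (fun j => cycleMax X S j ω) < cycleMax X S 0 ω}
  rw [h.measureReal_maxOver_cycleMax_le hm] at h1
  have hF0 := hF.nonneg u
  have h2 : (cycleMaxDF P X S u ^ (1 / μ)) ^ n - cycleMaxDF P X S u ^ m ≤ ε / 3 := by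
    rw [← Real.rpow_natCast, ← Real.rpow_natCast, ← Real.rpow_mul hF0]
    refine (rpow_sub_rpow_le hF0 (by positivity) hm' ?_).trans ?_
    · rw [one_div_mul_eq_div, div_le_iff₀ (by positivity)]
      have : 0 ≤ (m : ℝ) * μ * δ := by positivity
      linarith
    · refine le_trans ?_ hd.le
      have e : 1 - 1 / μ * n / m = (m * μ - n) / (m * μ) := by field_simp
      have hmμ : (n : ℝ) ≤ m * μ := by
        have : 0 ≤ (m : ℝ) * μ * δ := by positivity
        linarith
      have hdn : 0 < δ + μ / n := by positivity
      rw [e, div_le_iff₀ (by positivity)]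
      have e2 : m * μ - n ≤ δ * (m * μ) + μ * (1 - δ) := by linarith
      have e3 : μ ≤ μ / n * (m * μ) := by
        rw [div_mul_eq_mul_div, le_div_iff₀ hn']
        gcongr
      have : 0 ≤ μ * δ := by positivity
      linarith
  linarith

theorem IsRegenerative.isPhantomDF_cycleMaxDF_rpow [IsProbabilityMeasure P]
    (h : IsRegenerative P X S) (hint : Integrable (fun ω => (cycleLength S 1 ω : ℝ)) P)
    (hzero : Tendsto
      (fun n : ℕ => P.real {ω |
        maxOver (Finset.Icc 1 n) (fun j => cycleMax X S j ω) < cycleMax X S 0 ω})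
      atTop (𝓝 0)) :
    IsPhantomDF P X (fun x => cycleMaxDF P X S x ^ (1 / meanCycleLength P S)) := by
  have hμ : 0 < 1 / meanCycleLength P S :=
    one_div_pos.2 (one_pos.trans_le (h.one_le_meanCycleLength hint))
  refine ⟨h.isDistributionFunction_cycleMaxDF.rpow hμ, fun u => ?_⟩
  refine Metric.tendsto_nhds.2 fun ε hε => ?_
  filter_upwards [h.eventually_measureReal_le hint (half_pos hε),
    h.eventually_le_measureReal hint hzero (half_pos hε)] with n h1 h2
  have h1 := h1 (u n)
  have h2 := h2 (u n)
  rw [dist_zero_right, Real.norm_eq_abs, abs_lt]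
  constructor <;> linarith

end Regenerative

theorem mainTheorem11 {Ω : Type*} [MeasurableSpace Ω] (P : Measure Ω) [IsProbabilityMeasure P]
    (X : ℕ → Ω → ℝ) (S : ℕ → Ω → ℕ) (hreg : IsRegenerative P X S)
    (hmean : Integrable (fun ω => (cycleLength S 1 ω : ℝ)) P)
    (hzero : Tendsto
      (fun n : ℕ => P.real {ω |
        maxOver (Finset.Icc 1 n) (fun j => cycleMax X S j ω) < cycleMax X S 0 ω})
      atTop (𝓝 0)) :
    ((∃ G : ℝ → ℝ, Continuous G ∧ IsPhantomDF P X G) ↔ IsRegularDF (cycleMaxDF P X S)) ∧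
    (IsRegularDF (cycleMaxDF P X S) →
      IsPhantomDF P X (fun x => cycleMaxDF P X S x ^ (1 / meanCycleLength P S)) ∧
      IsRegularDF (fun x => cycleMaxDF P X S x ^ (1 / meanCycleLength P S))) := by
  have hph := hreg.isPhantomDF_cycleMaxDF_rpow hmean hzero
  have hμ : 0 < meanCycleLength P S := one_pos.trans_le (hreg.one_le_meanCycleLength hmean)
  have hF := hreg.isDistributionFunction_cycleMaxDF
  refine ⟨⟨?_, fun hr => ?_⟩, fun hr => ⟨hph, hr.rpow (one_div_pos.2 hμ)⟩⟩
  · rintro ⟨G, hGc, hG⟩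
    have h1 := isRegularDF_of_continuous hph.isDistributionFunction hG.isDistributionFunction hGc
      fun u => by simpa using (hph.tendsto_zero u).sub (hG.tendsto_zero u)
    -- The power `μ` undoes `1 / μ` and returns to the law of `Y_1`.
    have h2 := h1.rpow hμ
    have e : (fun x => (cycleMaxDF P X S x ^ (1 / meanCycleLength P S)) ^ meanCycleLength P S) =
        cycleMaxDF P X S := funext fun x => by
      rw [← Real.rpow_mul (hF.nonneg x), one_div_mul_cancel hμ.ne', Real.rpow_one]
    rwa [e] at h2
  · obtain ⟨H, hHc, hH, htail⟩ := (hr.rpow (one_div_pos.2 hμ)).exists_continuous_tail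
    refine ⟨H, hHc, hH, fun u => ?_⟩
    have h1 := tendsto_pow_sub_pow_of_tail hph.isDistributionFunction hH htail u
    simpa using (hph.tendsto_zero u).sub h1
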